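/- **Theorem 1.1.** Let $L$ be a finite (non-empty) lattice. A *join-irreducible* element is an element $j$, different from the least element, such that $j=x\vee y$ implies $j\in\{x,y\}$; it has a unique lower cover $j_*$. Call $L$ *congruence uniform* if, for $L$ and for its dual, there is a bijection between the set of join-irreducible elements of the lattice and the set of join-irreducible elements of its lattice of congruences (congruences being ordered by inclusion). Let $L$ be congruence uniform. Write $x\lessdot y$ if $y$ covers $x$. Two cover relations $x\lessdot y$ and $u\lessdot v$ are *perspective* if either $v\vee x=y$ and $v\wedge x=u$, or $u\vee y=v$ and $u\wedge y=x$. For $x\lessdot y$ let $\gamma(x,y)$ be the (unique) join-irreducible element $j$ such that $(x,y)$ and $(j_*,j)$ are perspective. For $x\in L$ let $x_\downarrow=\bigwedge\{y : y\lessdot x\}$ and $$\Psi(x)=\{\gamma(u,v) : x_\downarrow\le u\lessdot v\le x\}.$$ The *core label order* $\mathrm{CLO}(L)$ is the set $L$ with the order $x\sqsubseteq y\iff\Psi(x)\subseteq\Psi(y)$. For $x\in L$ let $\Gamma(x)$ be the *canonical join representation* of $x$, that is, the set $X\subseteq L$ such that $\bigvee X=x$, no proper subset of $X$ has join $x$,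 and for every $Y\subseteq L$ with $\bigvee Y=x$ every element of $X$ lies below some element of $Y$. The *canonical join complex* $\mathrm{Can}(L)$ is the simplicial complex (with the empty set as a face) whose faces are the sets $\Gamma(x)$, $x\in L$; its *face poset* is the set of its faces ordered by inclusion. Then $L$ is distributive if and only if $\mathrm{CLO}(L)$ is (isomorphic to) the face poset of $\mathrm{Can}(L)$. Moreover, $L$ is distributive if and only if the families of sets $\{\Psi(x) : x\in L\}$ and $\{\Gamma(x) : x\in L\}$ are equal. -/

import Mathlib

namespace LatticeCon

variable {α : Type*} [Lattice α]

theorem toSetoid_injective :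
    Function.Injective (fun c : LatticeCon α => c.toSetoid) := by
  rintro ⟨s, _, _⟩ ⟨t, _, _⟩ h
  cases h
  rfl

/-- Congruences of a lattice are ordered by inclusion of relations. -/
instance : PartialOrder (LatticeCon α) :=
  PartialOrder.lift (fun c => c.toSetoid) toSetoid_injective

/-- The meet of a family of congruences is the intersection of the relations. -/
instance : InfSet (LatticeCon α) where
  sInf S :=
    { r := fun x y => ∀ c ∈ S, c.r x y
      iseqv :=
        ⟨fun _ c _ => c.iseqv.refl _,
         fun h c hc => c.iseqv.symm (h c hc),
         fun h h' c hc => c.iseqv.trans (h c hc) (h' c hc)⟩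
      inf := fun h h' c hc => c.inf (h c hc) (h' c hc)
      sup := fun h h' c hc => c.sup (h c hc) (h' c hc) }

/-- The congruence lattice of a lattice. -/
instance : CompleteLattice (LatticeCon α) :=
  completeLatticeOfInf (LatticeCon α) fun _ =>
    ⟨fun _ hc _ _ h => h _ hc, fun _ hb _ _ h c hc => hb hc h⟩

end LatticeCon

/-- A lattice is congruence uniform if, for it and for its dual, the join-irreducible elements are
in bijection with the join-irreducible congruences. (`SupIrred` excludes the least element.) -/
def IsCongruenceUniform (L : Type*) [Lattice L] : Prop :=
  Nonempty ({j : L // SupIrred j} ≃ {θ : LatticeCon L // SupIrred θ}) ∧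
  Nonempty ({j : Lᵒᵈ // SupIrred j} ≃ {θ : LatticeCon Lᵒᵈ // SupIrred θ})

/-- Both distributive laws hold. -/
def IsDistributiveLattice (L : Type*) [Lattice L] : Prop :=
  ∀ x y z : L, x ⊓ (y ⊔ z) = (x ⊓ y) ⊔ (x ⊓ z) ∧ x ⊔ (y ⊓ z) = (x ⊔ y) ⊓ (x ⊔ z)

section CoreLabelOrder

variable {L : Type*} [Lattice L]

/-- Perspectivity of two cover relations `x ⋖ y` and `u ⋖ v`. -/
def Perspective (x y u v : L) : Prop :=
  (v ⊔ x = y ∧ v ⊓ x = u) ∨ (u ⊔ y = v ∧ u ⊓ y = x)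

/-- `IsCoverLabel x y j`: the join-irreducible element `j` is the label `γ(x, y)` of the cover
relation `x ⋖ y`, that is, `(x, y)` is perspective to `(j_*, j)`, where `j_*` is the lower cover
of `j`. -/
def IsCoverLabel (x y j : L) : Prop :=
  SupIrred j ∧ ∃ j' : L, j' ⋖ j ∧ Perspective x y j' j

/-- The nucleus `x_↓` of `x`: the meet of all lower covers of `x`. -/
noncomputable def nucleus [OrderTop L] [Finite L] (x : L) : L :=
  (Set.toFinite {y : L | y ⋖ x}).toFinset.inf id

/-- The set `Ψ(x)` of core labels of `x`: the labels of all cover relations in `[x_↓, x]`. -/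
def coreLabels [OrderTop L] [Finite L] (x : L) : Set L :=
  {j | ∃ u v : L, nucleus x ≤ u ∧ u ⋖ v ∧ v ≤ x ∧ IsCoverLabel u v j}

end CoreLabelOrder

/-- The elements of `L`, ordered by inclusion of their sets of core labels. -/
def CoreLabelOrder (L : Type*) : Type _ := L

instance {L : Type*} [Lattice L] [OrderTop L] [Finite L] : Preorder (CoreLabelOrder L) :=
  Preorder.lift fun x : L => coreLabels x

section CanonicalJoinComplex

variable {L : Type*} [Lattice L]

/-- `X` is the canonical join representation `Γ(x)` of `x`: it joins to `x`, no proper subset of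
`X` joins to `x`, and the order ideal generated by `X` is contained in the order ideal generated
by any other set that joins to `x`. -/
def IsCanonicalJoinRep (X : Set L) (x : L) : Prop :=
  IsLUB X x ∧ (∀ X' : Set L, X' ⊂ X → ¬ IsLUB X' x) ∧
    ∀ Y : Set L, IsLUB Y x → lowerClosure X ≤ lowerClosure Y

/-- In a finite lattice, every subset of a canonical join representation is again the canonical
join representation of some element. -/
theorem IsCanonicalJoinRep.subset [OrderBot L] [Finite L] {X Z : Set L} {x : L}
    (h : IsCanonicalJoinRep X x) (hZ : Z ⊆ X) : ∃ z, IsCanonicalJoinRep Z z := by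
  obtain ⟨hlub, hirr, hmin⟩ := h
  have key : ∀ a ∈ X, ∀ b ∈ X, a ≤ b → a = b := by
    intro a ha b hb hab
    by_contra hne
    refine hirr (X \ {a}) ⟨Set.sdiff_subset, fun hs => (hs ha).2 rfl⟩
      ⟨fun c hc => hlub.1 hc.1, fun u hu => hlub.2 fun c hc => ?_⟩
    by_cases hca : c = a
    · rw [hca]
      exact hab.trans (hu ⟨hb, fun h => hne h.symm⟩)
    · exact hu ⟨hc, hca⟩
  have hz : IsLUB Z ((Set.toFinite Z).toFinset.sup id) := by
    constructor
    · intro c hc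
      exact Finset.le_sup (f := id) ((Set.Finite.mem_toFinset _).2 hc)
    · intro u hu
      exact Finset.sup_le fun c hc => hu ((Set.Finite.mem_toFinset _).1 hc)
  have hrep : ∀ Y : Set L, IsLUB Y ((Set.toFinite Z).toFinset.sup id) →
      ∀ a ∈ Z, ∃ b ∈ Y, a ≤ b := by
    intro Y hY a ha
    have hW : IsLUB ((X \ Z) ∪ Y) x := by
      constructor
      · rintro c (hc | hc)
        · exact hlub.1 hc.1
        · exact (hY.1 hc).trans (hz.2 fun d hd => hlub.1 (hZ hd))
      · intro u hu
        refine hlub.2 fun c hc => ?_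
        by_cases hcZ : c ∈ Z
        · exact (hz.1 hcZ).trans (hY.2 fun d hd => hu (Or.inr hd))
        · exact hu (Or.inl ⟨hc, hcZ⟩)
    obtain ⟨b, hb, hab⟩ := hmin _ hW (subset_lowerClosure (hZ ha))
    rcases hb with hb | hb
    · have := key a (hZ ha) b hb.1 hab
      exact absurd (this ▸ ha) hb.2
    · exact ⟨b, hb, hab⟩
  refine ⟨_, hz, fun Z' hZ' hlub' => hZ'.2 fun a ha => ?_, fun Y hY c hc => ?_⟩
  · obtain ⟨b, hb, hab⟩ := hrep Z' hlub' a ha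
    rw [key a (hZ ha) b (hZ (hZ'.1 hb)) hab]
    exact hb
  · obtain ⟨a, ha, hca⟩ := hc
    obtain ⟨b, hb, hab⟩ := hrep Y hY a ha
    exact ⟨b, hb, hca.trans hab⟩

end CanonicalJoinComplex

/-- The canonical join complex of a finite lattice: the simplicial complex (a family of subsets
of `L` closed under taking subsets, the empty face included) whose faces are the canonical join
representations of the elements of `L`. As a type, it is the face poset, ordered by inclusion. -/
def canonicalJoinComplex (L : Type*) [Lattice L] [OrderBot L] [Finite L] : LowerSet (Set L) where
  carrier := {X | ∃ x : L, IsCanonicalJoinRep X x}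
  lower' := fun _ _ hZX ⟨_, hx⟩ => hx.subset hZX

/-!
For a cover `u ⋖ v`, an element that is minimal among those below `v` and not below `u` is
join-irreducible and labels the cover. Hence every congruence is a join of principal congruences
`cg(j_*, j)`, every join-irreducible congruence is one of these, and if the numbers of
join-irreducible elements and congruences agree, then `j ↦ cg(j_*, j)` is injective
(`eq_of_forall_con_iff`). As perspective covers generate the same congruence, labels are unique
(`IsCongruenceUniform.uniqueLabels`), and by duality there is for every join-irreducible `j` a
single element `κ(j)` such that every cover `u ⋖ v` labelled by `j` satisfies `u ≤ κ(j)` and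
`¬ j ≤ κ(j)` (`IsCongruenceUniform.exists_kappa`).

Unique labels make the set of labels of the lower covers of `x` the canonical join representation
`Γ(x)`, so that always `Γ(x) ⊆ Ψ(x)`. If `L` is distributive, join-irreducible elements are prime
and the two sets agree. Both the equality of the two families and, by counting atoms below
corresponding elements, the existence of an isomorphism force `Ψ(x) = Γ(x)` for all `x`.

Suppose that `Ψ(x) = Γ(x)` for all `x`. If `u ≠ w` are lower covers of `x`, then the label of a
cover in `[u ⊓ w, w]` lies in `Γ(x)`, and it can only be the label of `u ⋖ x`, because the other
elements of `Γ(x)` are below `u`. As labels do not repeat along a chain,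
`u ⊓ w ⋖ w`. By induction on `v`, every join-irreducible `j` below `v` but not below `u`, where
`u ⋖ v`, is the label of `u ⋖ v`. Now if `¬ j ≤ y`, a maximal chain from `y` to `⊤` passes through
a cover that `j` labels, so `y ≤ κ(j)`. Hence `j` is join-prime, and `L` is distributive.
-/

/-! ### Labels of cover relations -/

section Labels

variable {L : Type*} [Lattice L]

theorem SupIrred.eq_of_covBy {j a b : L} (hj : SupIrred j) (ha : a ⋖ j) (hb : b ⋖ j) : a = b := by
  by_contra hne
  rcases hj.2 (ha.wcovBy.sup_eq hb.wcovBy hne) with h | h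
  · exact ha.lt.ne h
  · exact hb.lt.ne h

/-- Of the two cases of perspectivity to `(j_*, j)`, the second one occurs only for the cover
`j_* ⋖ j` itself, so that the first one is enough. -/
theorem isCoverLabel_iff {u v j : L} (huv : u ⋖ v) :
    IsCoverLabel u v j ↔ SupIrred j ∧ j ⊔ u = v ∧ j ⊓ u ⋖ j := by
  constructor
  · rintro ⟨hj, j', hj', ⟨h1, h2⟩ | ⟨h1, h2⟩⟩
    · exact ⟨hj, h1, h2 ▸ hj'⟩
    · rcases hj.2 h1 with h | h
      · exact absurd h hj'.lt.ne
      · subst h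
        have hu : u ≤ j' := h2 ▸ inf_le_left
        rcases huv.wcovBy.eq_or_eq hu hj'.le with h | h
        · subst h
          refine ⟨hj, sup_eq_left.2 huv.le, ?_⟩
          rwa [inf_eq_right.2 huv.le]
        · exact absurd h hj'.lt.ne
  · rintro ⟨hj, h1, h2⟩
    exact ⟨hj, j ⊓ u, h2, Or.inl ⟨h1, rfl⟩⟩

theorem IsCoverLabel.supIrred {u v j : L} (h : IsCoverLabel u v j) : SupIrred j := h.1

theorem IsCoverLabel.le {u v j : L} (h : IsCoverLabel u v j) (huv : u ⋖ v) : j ≤ v :=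
  ((isCoverLabel_iff huv).1 h).2.1 ▸ le_sup_left

theorem IsCoverLabel.not_le {u v j : L} (h : IsCoverLabel u v j) (huv : u ⋖ v) : ¬ j ≤ u :=
  fun hju => ((isCoverLabel_iff huv).1 h).2.2.lt.ne (inf_eq_left.2 hju)

theorem SupIrred.isCoverLabel {j' j : L} (hj : SupIrred j) (h : j' ⋖ j) : IsCoverLabel j' j j :=
  (isCoverLabel_iff h).2 ⟨hj, sup_eq_left.2 h.le, by rwa [inf_eq_right.2 h.le]⟩

/-- An element minimal among those below `z` but not below `u` is a label of `u ⋖ v`. -/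
theorem exists_isCoverLabel_le [Finite L] {u v z : L} (huv : u ⋖ v) (hzv : z ≤ v)
    (hzu : ¬ z ≤ u) : ∃ j ≤ z, IsCoverLabel u v j := by
  obtain ⟨j, ⟨hjz, hju⟩, hmin⟩ :=
    (Set.toFinite {j : L | j ≤ z ∧ ¬ j ≤ u}).exists_minimal ⟨z, le_rfl, hzu⟩
  have below : ∀ x < j, x ≤ u := fun x hx => by
    by_contra hxu
    exact hx.not_ge (hmin ⟨hx.le.trans hjz, hxu⟩ hx.le)
  refine ⟨j, hjz, (isCoverLabel_iff huv).2 ⟨⟨fun h => ?_, fun a b hab => ?_⟩, ?_, ?_, ?_⟩⟩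
  · exact hju ((h inf_le_left : j ≤ j ⊓ u).trans inf_le_right)
  · by_contra! hne
    exact hju (hab ▸ sup_le (below a (lt_of_le_of_ne (hab ▸ le_sup_left) hne.1))
      (below b (lt_of_le_of_ne (hab ▸ le_sup_right) hne.2)))
  · exact (huv.wcovBy.eq_or_eq le_sup_right (sup_le (hjz.trans hzv) huv.le)).resolve_left
      fun h => hju (h ▸ le_sup_left)
  · exact inf_lt_left.2 hju
  · exact fun x hx hxj => hx.not_ge (le_inf hxj.le (below x hxj))

theorem exists_isCoverLabel [Finite L] {u v : L} (huv : u ⋖ v) : ∃ j, IsCoverLabel u v j :=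
  let ⟨j, _, hj⟩ := exists_isCoverLabel_le huv le_rfl huv.lt.not_ge
  ⟨j, hj⟩

theorem SupIrred.exists_covBy [Finite L] {j : L} (hj : SupIrred j) : ∃ j', j' ⋖ j := by
  obtain ⟨b, hb⟩ := not_isMin_iff.1 hj.1
  obtain ⟨j', -, hj'⟩ := exists_le_covBy_of_lt hb
  exact ⟨j', hj'⟩

end Labels

/-! ### Congruences and uniqueness of labels -/

section Congruences

variable {L : Type*} [Lattice L]

theorem LatticeCon.r_iff_of_isCoverLabel (c : LatticeCon L) {u v j j' : L} (huv : u ⋖ v)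
    (h : IsCoverLabel u v j) (hj' : j' ⋖ j) : c.r u v ↔ c.r j' j := by
  obtain ⟨hj, hs, hi⟩ := (isCoverLabel_iff huv).1 h
  obtain rfl := hj.eq_of_covBy hi hj'
  constructor
  · intro hc
    have := c.inf (c.iseqv.refl j) hc
    rwa [inf_eq_left.2 (h.le huv)] at this
  · intro hc
    have := c.sup hc (c.iseqv.refl u)
    rwa [hs, sup_eq_right.2 inf_le_right] at this

/-- A congruence is determined by the covers `j_* ⋖ j` of join-irreducible elements that it
contracts. -/
theorem LatticeCon.le_of_forall_supIrred [Finite L] {c d : LatticeCon L}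
    (h : ∀ j' j : L, SupIrred j → j' ⋖ j → c.r j' j → d.r j' j) : c ≤ d := by
  have key : ∀ y x : L, x ≤ y → c.r x y → d.r x y := by
    intro y
    induction y using WellFoundedLT.induction with
    | ind y ih =>
      intro x hxy hc
      rcases hxy.eq_or_lt with rfl | hlt
      · exact d.iseqv.refl _
      obtain ⟨u, hxu, huy⟩ := exists_le_covBy_of_lt hlt
      have hxu' : c.r x u := by
        have := c.inf hc (c.iseqv.refl u)
        rwa [inf_eq_left.2 hxu, inf_eq_right.2 huy.le] at this
      obtain ⟨j, hj⟩ := exists_isCoverLabel huy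
      obtain ⟨j', hj'⟩ := hj.supIrred.exists_covBy
      refine d.iseqv.trans (ih u huy.lt x hxu hxu') ?_
      exact (d.r_iff_of_isCoverLabel huy hj hj').2 (h j' j hj.supIrred hj'
        ((c.r_iff_of_isCoverLabel huy hj hj').1 (c.iseqv.trans (c.iseqv.symm hxu') hc)))
  intro x y hxy
  exact d.r_inf_sup_iff.1 (key _ _ inf_le_sup (c.r_inf_sup_iff.2 hxy))

/-- Every join-irreducible congruence is generated by a pair `(j_*, j)`, where `j` is
join-irreducible. -/
theorem LatticeCon.exists_supIrred_forall_le_iff [Finite L] {θ : LatticeCon L} (hθ : SupIrred θ) :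
    ∃ j : L, SupIrred j ∧ ∀ j', j' ⋖ j → ∀ c : LatticeCon L, θ ≤ c ↔ c.r j' j := by
  have hgen : ∀ (a b : L) (c : LatticeCon L), sInf {d : LatticeCon L | d.r a b} ≤ c ↔ c.r a b :=
    fun a b c => ⟨fun h => h fun _ hd => hd, fun h => sInf_le h⟩
  let S := (Set.toFinite {p : L × L | SupIrred p.2 ∧ p.1 ⋖ p.2 ∧ θ.r p.1 p.2}).toFinset
  have hS : S.sup (fun p => sInf {d : LatticeCon L | d.r p.1 p.2}) = θ := by
    apply le_antisymm
    · refine Finset.sup_le fun p hp => (hgen _ _ _).2 ?_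
      exact ((Set.Finite.mem_toFinset _).1 hp).2.2
    · refine LatticeCon.le_of_forall_supIrred fun j' j hj hj' hr => ?_
      rw [← hgen]
      exact Finset.le_sup (f := fun p : L × L => sInf {d : LatticeCon L | d.r p.1 p.2})
        (b := (j', j)) ((Set.Finite.mem_toFinset _).2 ⟨hj, hj', hr⟩)
  obtain ⟨⟨i, j⟩, hp, rfl⟩ := hθ.finset_sup_eq hS
  obtain ⟨hj, hij, -⟩ := (Set.Finite.mem_toFinset _).1 hp
  refine ⟨j, hj, fun j' hj' c => ?_⟩
  rw [hj.eq_of_covBy hj' hij]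
  exact hgen i j c

/-- If there are as many join-irreducible elements as join-irreducible congruences, then different
join-irreducible elements `j` generate different congruences `cg(j_*, j)`. -/
theorem eq_of_forall_con_iff [Finite L]
    (e : {j : L // SupIrred j} ≃ {θ : LatticeCon L // SupIrred θ}) {j k j' k' : L}
    (hj : SupIrred j) (hk : SupIrred k) (hj' : j' ⋖ j) (hk' : k' ⋖ k)
    (h : ∀ c : LatticeCon L, c.r j' j ↔ c.r k' k) : j = k := by
  choose g hg hgc using fun θ : {θ : LatticeCon L // SupIrred θ} =>
    LatticeCon.exists_supIrred_forall_le_iff θ.2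
  have hinj : Function.Injective fun a => (⟨g (e a), hg (e a)⟩ : {j : L // SupIrred j}) := by
    intro a b hab
    have hab' : g (e a) = g (e b) := congrArg Subtype.val hab
    obtain ⟨i, hi⟩ := (hg (e a)).exists_covBy
    have hiff : ∀ c, (e a).1 ≤ c ↔ (e b).1 ≤ c := fun c => by
      rw [hgc _ i hi, hgc _ i (hab' ▸ hi), hab']
    exact e.injective (Subtype.ext (le_antisymm ((hiff _).2 le_rfl) ((hiff _).1 le_rfl)))
  have hsurj := Finite.surjective_of_injective hinj
  obtain ⟨a, ha⟩ := hsurj ⟨j, hj⟩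
  obtain ⟨b, hb⟩ := hsurj ⟨k, hk⟩
  obtain rfl : g (e a) = j := congrArg Subtype.val ha
  obtain rfl : g (e b) = k := congrArg Subtype.val hb
  have hiff : ∀ c, (e a).1 ≤ c ↔ (e b).1 ≤ c := fun c => by
    rw [hgc _ _ hj', hgc _ _ hk', h]
  rw [show e a = e b from
    Subtype.ext (le_antisymm ((hiff _).2 le_rfl) ((hiff _).1 le_rfl))]

/-- Every cover relation has at most one label. -/
def UniqueLabels (L : Type*) [Lattice L] : Prop :=
  ∀ ⦃u v j k : L⦄, u ⋖ v → IsCoverLabel u v j → IsCoverLabel u v k → j = k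

theorem IsCongruenceUniform.uniqueLabels [Finite L] (hL : IsCongruenceUniform L) :
    UniqueLabels L := by
  intro u v j k huv hj hk
  obtain ⟨⟨e⟩, -⟩ := hL
  obtain ⟨j', hj'⟩ := hj.supIrred.exists_covBy
  obtain ⟨k', hk'⟩ := hk.supIrred.exists_covBy
  refine eq_of_forall_con_iff e hj.supIrred hk.supIrred hj' hk' fun c => ?_
  rw [← c.r_iff_of_isCoverLabel huv hj hj', c.r_iff_of_isCoverLabel huv hk hk']

/-- The relation of a congruence is a congruence of the dual lattice. -/
def LatticeCon.ofOrderDual (c : LatticeCon Lᵒᵈ) : LatticeCon L where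
  r x y := c.r (OrderDual.toDual x) (OrderDual.toDual y)
  iseqv := ⟨fun _ => c.iseqv.refl _, fun h => c.iseqv.symm h, fun h h' => c.iseqv.trans h h'⟩
  inf h h' := c.sup h h'
  sup h h' := c.inf h h'

/-- For a join-irreducible `j`, the covers labelled by `j` have a common label `κ(j)` in the dual
lattice. It is above the lower elements of all these covers, but not above `j`. -/
theorem IsCongruenceUniform.exists_kappa [Finite L] (hL : IsCongruenceUniform L) {j : L}
    (hj : SupIrred j) :
    ∃ m : L, ¬ j ≤ m ∧ ∀ u v : L, u ⋖ v → IsCoverLabel u v j → u ≤ m := by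
  have hfin : Finite Lᵒᵈ := ‹Finite L›
  obtain ⟨-, ⟨e⟩⟩ := hL
  obtain ⟨j', hj'⟩ := hj.exists_covBy
  obtain ⟨m, hm⟩ := exists_isCoverLabel (L := Lᵒᵈ) hj'.toDual
  have hjm : ¬ j ≤ OrderDual.ofDual m := fun h => hm.not_le hj'.toDual h
  refine ⟨OrderDual.ofDual m, hjm, fun u v huv hl => ?_⟩
  obtain ⟨n, hn⟩ := exists_isCoverLabel (L := Lᵒᵈ) huv.toDual
  obtain ⟨m', hm'⟩ := hm.supIrred.exists_covBy
  obtain ⟨n', hn'⟩ := hn.supIrred.exists_covBy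
  have hnm : n = m := by
    refine eq_of_forall_con_iff e hn.supIrred hm.supIrred hn' hm' fun c => ?_
    rw [← c.r_iff_of_isCoverLabel huv.toDual hn hn', ← c.r_iff_of_isCoverLabel hj'.toDual hm hm']
    have hc := c.ofOrderDual.r_iff_of_isCoverLabel huv hl hj'
    exact ⟨fun h => c.iseqv.symm (hc.1 (c.iseqv.symm h)),
      fun h => c.iseqv.symm (hc.2 (c.iseqv.symm h))⟩
  have hun : u ≤ OrderDual.ofDual n := hn.le huv.toDual
  exact hnm ▸ hun

end Congruences

/-! ### Canonical join representations -/

section CanonicalJoin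

variable {L : Type*} [Lattice L]

/-- The set of labels of the cover relations `u ⋖ x`. -/
def lowerLabels (x : L) : Set L :=
  {j | ∃ u, u ⋖ x ∧ IsCoverLabel u x j}

theorem le_of_isCoverLabel_of_ne [Finite L] (hU : UniqueLabels L) {x u w j : L} (hu : u ⋖ x)
    (hw : w ⋖ x) (huw : w ≠ u) (hj : IsCoverLabel w x j) : j ≤ u := by
  obtain ⟨k, hku, hk⟩ := exists_isCoverLabel_le hw hu.le
    fun h => (hu.wcovBy.eq_or_eq h hw.le).elim huw hw.lt.ne
  exact hU hw hj hk ▸ hku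

theorem isLUB_of_lowerLabels_subset [Finite L] {x : L} {X : Set L} (hX : lowerLabels x ⊆ X)
    (hle : ∀ j ∈ X, j ≤ x) : IsLUB X x := by
  refine ⟨hle, fun b hb => ?_⟩
  by_contra hxb
  obtain ⟨u, hu, hux⟩ := exists_le_covBy_of_lt (inf_lt_left.2 hxb)
  obtain ⟨j, hj⟩ := exists_isCoverLabel hux
  exact hj.not_le hux ((le_inf (hj.le hux) (hb (hX ⟨u, hux, hj⟩))).trans hu)

theorem isCanonicalJoinRep_lowerLabels [Finite L] (hU : UniqueLabels L) (x : L) :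
    IsCanonicalJoinRep (lowerLabels x) x := by
  refine ⟨isLUB_of_lowerLabels_subset subset_rfl ?_, ?_, ?_⟩
  · rintro j ⟨u, hu, hj⟩
    exact hj.le hu
  · intro X' hX' hlub
    obtain ⟨j, ⟨u, hu, hj⟩, hjX⟩ := Set.exists_of_ssubset hX'
    refine hu.lt.not_ge (hlub.2 fun k hk => ?_)
    obtain ⟨w, hw, hkw⟩ := hX'.1 hk
    refine le_of_isCoverLabel_of_ne hU hu hw ?_ hkw
    rintro rfl
    exact hjX (hU hu hkw hj ▸ hk)
  · rintro Y hY a ⟨j, ⟨u, hu, hj⟩, haj⟩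
    have hex : ∃ y ∈ Y, ¬ y ≤ u := by
      by_contra! h
      exact hu.lt.not_ge (hY.2 h)
    obtain ⟨y, hy, hyu⟩ := hex
    obtain ⟨k, hky, hk⟩ := exists_isCoverLabel_le hu (hY.1 hy) hyu
    exact ⟨y, hy, haj.trans (hU hu hj hk ▸ hky)⟩

theorem IsCanonicalJoinRep.isAntichain {X : Set L} {x : L} (h : IsCanonicalJoinRep X x) :
    IsAntichain (· ≤ ·) X := by
  intro a ha b hb hne hab
  refine h.2.1 (X \ {a}) ⟨Set.sdiff_subset, fun hs => (hs ha).2 rfl⟩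
    ⟨fun c hc => h.1.1 hc.1, fun u hu => h.1.2 fun c hc => ?_⟩
  by_cases hca : c = a
  · exact hca ▸ hab.trans (hu ⟨hb, hne.symm⟩)
  · exact hu ⟨hc, hca⟩

theorem IsCanonicalJoinRep.unique {X Y : Set L} {x : L} (hX : IsCanonicalJoinRep X x)
    (hY : IsCanonicalJoinRep Y x) : X = Y := by
  have aux : ∀ {X Y : Set L}, IsCanonicalJoinRep X x → IsCanonicalJoinRep Y x → X ⊆ Y := by
    intro X Y hX hY a ha
    obtain ⟨b, hb, hab⟩ := hX.2.2 Y hY.1 (subset_lowerClosure ha)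
    obtain ⟨c, hc, hbc⟩ := hY.2.2 X hX.1 (subset_lowerClosure hb)
    obtain rfl := hX.isAntichain.eq ha hc (hab.trans hbc)
    exact le_antisymm hab hbc ▸ hb
  exact (aux hX hY).antisymm (aux hY hX)

end CanonicalJoin

/-! ### Core labels -/

section CoreLabels

variable {L : Type*} [Lattice L] [BoundedOrder L] [Finite L]

theorem nucleus_le {x y : L} (h : y ⋖ x) : nucleus x ≤ y :=
  Finset.inf_le (f := id) ((Set.Finite.mem_toFinset _).2 h)

theorem le_nucleus_iff {x z : L} : z ≤ nucleus x ↔ ∀ y, y ⋖ x → z ≤ y := by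
  simp [nucleus]

theorem lowerLabels_subset_coreLabels (x : L) : lowerLabels x ⊆ coreLabels x :=
  fun _ ⟨u, hu, hj⟩ => ⟨u, x, nucleus_le hu, hu, le_rfl, hj⟩

theorem le_of_mem_coreLabels {x j : L} (h : j ∈ coreLabels x) : j ≤ x := by
  obtain ⟨u, v, -, huv, hv, hj⟩ := h
  exact (hj.le huv).trans hv

theorem isLUB_coreLabels (x : L) : IsLUB (coreLabels x) x :=
  isLUB_of_lowerLabels_subset (lowerLabels_subset_coreLabels x) fun _ => le_of_mem_coreLabels

theorem supIrred_of_mem_coreLabels {x j : L} (h : j ∈ coreLabels x) : SupIrred j := by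
  obtain ⟨u, v, -, -, -, hj⟩ := h
  exact hj.supIrred

theorem coreLabels_bot : coreLabels (⊥ : L) = ∅ := by
  ext j
  simp only [Set.mem_empty_iff_false, iff_false]
  exact fun h => (supIrred_of_mem_coreLabels h).ne_bot (le_bot_iff.1 (le_of_mem_coreLabels h))

theorem SupIrred.coreLabels_eq (hU : UniqueLabels L) {j : L} (hj : SupIrred j) :
    coreLabels j = {j} := by
  obtain ⟨j', hj'⟩ := hj.exists_covBy
  have hnuc : j' ≤ nucleus j := le_nucleus_iff.2 fun y hy => (hj.eq_of_covBy hj' hy).le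
  refine Set.Subset.antisymm ?_
    (Set.singleton_subset_iff.2 (lowerLabels_subset_coreLabels j ⟨j', hj', hj.isCoverLabel hj'⟩))
  rintro k ⟨u, v, hu, huv, hv, hk⟩
  have hju := hnuc.trans hu
  obtain rfl : v = j :=
    (hj'.wcovBy.eq_or_eq (hju.trans huv.le) hv).resolve_left fun h => (h ▸ huv.lt).not_ge hju
  obtain rfl : u = j' := hj.eq_of_covBy huv hj'
  exact hU huv hk (hj.isCoverLabel huv)

/-- In a distributive lattice the labels are prime, so that a core label of `x` is also the label
of any cover `y ⋖ x` with `¬ j ≤ y`. -/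
theorem coreLabels_eq_lowerLabels_of_distributive (hD : IsDistributiveLattice L) (x : L) :
    coreLabels x = lowerLabels x := by
  refine Set.Subset.antisymm ?_ (lowerLabels_subset_coreLabels x)
  rintro j hjx
  have hle := le_of_mem_coreLabels hjx
  obtain ⟨u, v, hu, huv, hv, hj⟩ := hjx
  have hnot : ¬ j ≤ nucleus x := fun h => hj.not_le huv (h.trans hu)
  rw [le_nucleus_iff] at hnot
  push Not at hnot
  obtain ⟨y, hy, hjy⟩ := hnot
  obtain ⟨k, hkj, hk⟩ := exists_isCoverLabel_le hy hle hjy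
  have hsup := ((isCoverLabel_iff hy).1 hk).2.1
  have hjk : j ≤ k := by
    have h : (j ⊓ k) ⊔ (j ⊓ y) = j := by
      rw [← (hD j k y).1, hsup, inf_eq_left.2 hle]
    rcases hj.supIrred.2 h with h | h
    · exact inf_eq_left.1 h
    · exact absurd (inf_eq_left.1 h) hjy
  exact ⟨y, hy, le_antisymm hjk hkj ▸ hk⟩

/-- If all core labels of `x` are labels of lower covers of `x`, then the meet of two lower covers
`u` and `w` of `x` is covered by `w`, with the label of `u ⋖ x`. -/
theorem inf_covBy_and_isCoverLabel (hU : UniqueLabels L) {x u w j : L}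
    (h : coreLabels x ⊆ lowerLabels x) (hu : u ⋖ x) (hw : w ⋖ x) (huw : u ≠ w)
    (hj : IsCoverLabel u x j) : u ⊓ w ⋖ w ∧ IsCoverLabel (u ⊓ w) w j := by
  have hlab : ∀ a b k, u ⊓ w ≤ a → a ⋖ b → b ≤ w → IsCoverLabel a b k → k = j := by
    intro a b k ha hab hb hk
    obtain ⟨y, hy, hky⟩ := h ⟨a, b, (le_inf (nucleus_le hu) (nucleus_le hw)).trans ha, hab,
      hb.trans hw.le, hk⟩
    by_cases hyu : y = u
    · exact hU hu (hyu ▸ hky) hj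
    · have hku := le_of_isCoverLabel_of_ne hU hu hy hyu hky
      exact absurd ((le_inf hku ((hk.le hab).trans hb)).trans ha) (hk.not_le hab)
  have hlt : u ⊓ w < w :=
    inf_lt_right.2 fun hwu => (hw.wcovBy.eq_or_eq hwu hu.le).elim huw hu.lt.ne
  obtain ⟨a, ha, haw⟩ := exists_le_covBy_of_lt hlt
  have hcov : u ⊓ w ⋖ w := by
    rcases ha.eq_or_lt with ha' | ha'
    · exact ha' ▸ haw
    -- The last two covers of a longer chain would have the same label `j`, which is impossible.
    · obtain ⟨b, hb, hba⟩ := exists_le_covBy_of_lt ha'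
      obtain ⟨k, hk⟩ := exists_isCoverLabel haw
      obtain ⟨l, hl⟩ := exists_isCoverLabel hba
      have hkl : l = k :=
        (hlab b a l hb hba haw.le hl).trans (hlab a w k ha haw le_rfl hk).symm
      exact absurd (hkl ▸ hl.le hba) (hk.not_le haw)
  obtain ⟨k, hk⟩ := exists_isCoverLabel hcov
  exact ⟨hcov, hlab _ w k le_rfl hcov le_rfl hk ▸ hk⟩

theorem isCoverLabel_of_le_of_not_le (hU : UniqueLabels L)
    (h : ∀ x : L, coreLabels x ⊆ lowerLabels x) {j : L} (hj : SupIrred j) (v : L) :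
    ∀ u, u ⋖ v → j ≤ v → ¬ j ≤ u → IsCoverLabel u v j := by
  induction v using WellFoundedLT.induction with
  | ind v ih =>
    intro u huv hjv hju
    rcases hjv.eq_or_lt with rfl | hlt
    · exact hj.isCoverLabel huv
    obtain ⟨w, hjw, hwv⟩ := exists_le_covBy_of_lt hlt
    obtain ⟨k, hk⟩ := exists_isCoverLabel huv
    obtain ⟨hcov, hlab⟩ :=
      inf_covBy_and_isCoverLabel hU (h v) huv hwv (fun e => hju (e ▸ hjw)) hk
    have := ih w hwv.lt _ hcov hjw fun hle => hju (hle.trans inf_le_left)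
    exact hU hcov hlab this ▸ hk

theorem isDistributiveLattice_of_supPrime (h : ∀ j : L, SupIrred j → SupPrime j) :
    IsDistributiveLattice L := by
  have hle : ∀ {a b : L}, (∀ j, SupIrred j → j ≤ a → j ≤ b) → a ≤ b := by
    intro a b hab
    obtain ⟨s, rfl, hs⟩ := exists_supIrred_decomposition a
    exact Finset.sup_le fun j hj => hab j (hs hj) (Finset.le_sup (f := id) hj)
  intro x y z
  constructor
  · refine le_antisymm (hle fun j hj hjx => ?_) le_inf_sup
    rcases (h j hj).le_sup.1 (hjx.trans inf_le_right) with hy | hz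
    · exact (le_inf (hjx.trans inf_le_left) hy).trans le_sup_left
    · exact (le_inf (hjx.trans inf_le_left) hz).trans le_sup_right
  · refine le_antisymm sup_inf_le (hle fun j hj hjx => ?_)
    rcases (h j hj).le_sup.1 (hjx.trans inf_le_left) with hx | hy
    · exact hx.trans le_sup_left
    rcases (h j hj).le_sup.1 (hjx.trans inf_le_right) with hx | hz
    · exact hx.trans le_sup_left
    · exact (le_inf hy hz).trans le_sup_right

theorem IsCongruenceUniform.isDistributiveLattice (hL : IsCongruenceUniform L)
    (h : ∀ x : L, coreLabels x ⊆ lowerLabels x) : IsDistributiveLattice L := by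
  refine isDistributiveLattice_of_supPrime fun j hj => ?_
  obtain ⟨m, hjm, hm⟩ := hL.exists_kappa hj
  have hle : ∀ z y : L, j ≤ z → y ≤ z → ¬ j ≤ y → y ≤ m := by
    intro z
    induction z using WellFoundedLT.induction with
    | ind z ih =>
      intro y hjz hyz hjy
      obtain ⟨u, hyu, huz⟩ :=
        exists_le_covBy_of_lt (lt_of_le_of_ne hyz fun e => hjy (e ▸ hjz))
      by_cases hju : j ≤ u
      · exact ih u huz.lt y hju hyu hjy
      · exact hyu.trans
          (hm u z huz (isCoverLabel_of_le_of_not_le hL.uniqueLabels h hj z u huz hjz hju))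
  refine ⟨hj.1, fun a b hab => ?_⟩
  by_contra! hne
  exact hjm (hab.trans (sup_le (hle ⊤ a le_top le_top hne.1) (hle ⊤ b le_top le_top hne.2)))

end CoreLabels

/-! ### The face poset of the canonical join complex -/

section FacePoset

variable {L : Type*} [Lattice L] [BoundedOrder L] [Finite L]

/-- The elements of `L` correspond to the faces of the canonical join complex via `x ↦ Γ(x)`. -/
noncomputable def equivFaces (hU : UniqueLabels L) :
    L ≃ {F : Set L // F ∈ canonicalJoinComplex L} :=
  Equiv.ofBijective (fun x => ⟨lowerLabels x, x, isCanonicalJoinRep_lowerLabels hU x⟩) <| by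
    constructor
    · intro x y hxy
      have hxy' : lowerLabels x = lowerLabels y := congrArg Subtype.val hxy
      exact (isCanonicalJoinRep_lowerLabels hU x).1.unique
        (hxy' ▸ (isCanonicalJoinRep_lowerLabels hU y).1)
    · rintro ⟨F, x, hx⟩
      exact ⟨x, Subtype.ext ((isCanonicalJoinRep_lowerLabels hU x).unique hx)⟩

/-- An isomorphism sends the join-irreducible elements, which are atoms of the core label order, to
one-element faces. -/
theorem exists_orderIso_eq_singleton (hU : UniqueLabels L)
    (f : CoreLabelOrder L ≃o {F : Set L // F ∈ canonicalJoinComplex L}) {j : L}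
    (hj : SupIrred j) : ∃ a : L, (f j).1 = {a} := by
  have hle : ∀ x y : L, (f x).1 ⊆ (f y).1 ↔ coreLabels x ⊆ coreLabels y :=
    fun x y => f.le_iff_le (x := x) (y := y)
  have hface : ∀ F ⊆ (f j).1, ∃ x : L, (f x).1 = F := fun F hF => by
    obtain ⟨x, hx⟩ := f.surjective ⟨F, (canonicalJoinComplex L).lower hF (f j).2⟩
    exact ⟨x, congrArg Subtype.val hx⟩
  have hbot : (f (⊥ : L)).1 = ∅ := by
    obtain ⟨x, hx⟩ := hface ∅ (Set.empty_subset _)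
    refine Set.subset_empty_iff.1 (hx ▸ (hle ⊥ x).2 ?_)
    rw [coreLabels_bot]
    exact Set.empty_subset _
  have hne : (f j).1.Nonempty := by
    rw [Set.nonempty_iff_ne_empty]
    intro h0
    have h := (hle j ⊥).1 (h0 ▸ Set.empty_subset _)
    rw [coreLabels_bot, hj.coreLabels_eq hU] at h
    exact h rfl
  obtain ⟨a, ha⟩ := hne
  obtain ⟨x, hx⟩ := hface {a} (Set.singleton_subset_iff.2 ha)
  refine ⟨a, Set.Subset.antisymm ?_ (Set.singleton_subset_iff.2 ha)⟩
  have hxj : coreLabels x ⊆ {j} :=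
    hj.coreLabels_eq hU ▸ (hle x j).1 (hx ▸ Set.singleton_subset_iff.2 ha)
  rcases Set.subset_singleton_iff_eq.1 hxj with h | h
  · have h' := (hle x ⊥).2 (h ▸ Set.empty_subset _)
    rw [hx, hbot] at h'
    exact absurd (h' (Set.mem_singleton a)) (Set.notMem_empty a)
  · exact hx ▸ (hle j x).2 (by rw [h, hj.coreLabels_eq hU])

theorem ncard_coreLabels_le (hU : UniqueLabels L)
    (f : CoreLabelOrder L ≃o {F : Set L // F ∈ canonicalJoinComplex L}) (x : L) :
    (coreLabels x).ncard ≤ (f x).1.ncard := by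
  have hle : ∀ x y : L, (f x).1 ⊆ (f y).1 ↔ coreLabels x ⊆ coreLabels y :=
    fun x y => f.le_iff_le (x := x) (y := y)
  choose! g hg using fun (j : L) (hj : SupIrred j) => exists_orderIso_eq_singleton hU f hj
  refine Set.ncard_le_ncard_of_injOn g (fun j hj => ?_) (fun j hj k hk hjk => ?_)
  · have hjs := supIrred_of_mem_coreLabels hj
    have h := (hle j x).2 (by rw [hjs.coreLabels_eq hU]; exact Set.singleton_subset_iff.2 hj)
    rw [hg j hjs] at h
    exact h rfl
  · have hjs := supIrred_of_mem_coreLabels hj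
    have hks := supIrred_of_mem_coreLabels hk
    have h := (hle j k).1 (by rw [hg j hjs, hg k hks, hjk])
    rw [hjs.coreLabels_eq hU, hks.coreLabels_eq hU] at h
    exact h rfl

/-- `|Γ(x)| ≤ |Ψ(x)| ≤ |f(x)|` for all `x`, and the outer terms have the same sum, as `Γ` and `f`
both enumerate the faces. -/
theorem coreLabels_subset_of_orderIso (hU : UniqueLabels L)
    (f : CoreLabelOrder L ≃o {F : Set L // F ∈ canonicalJoinComplex L}) (x : L) :
    coreLabels x ⊆ lowerLabels x := by
  have : Fintype L := Fintype.ofFinite L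
  have : Fintype {F : Set L // F ∈ canonicalJoinComplex L} := Fintype.ofFinite _
  have hsum : ∑ y : L, (lowerLabels y).ncard = ∑ y : L, (f y).1.ncard := by
    have h1 : ∑ y : L, (lowerLabels y).ncard =
        ∑ F : {F : Set L // F ∈ canonicalJoinComplex L}, F.1.ncard :=
      (equivFaces hU).sum_comp fun F => F.1.ncard
    have h2 : ∑ y : L, (f y).1.ncard =
        ∑ F : {F : Set L // F ∈ canonicalJoinComplex L}, F.1.ncard :=
      Equiv.sum_comp (ι := L) f.toEquiv fun F => F.1.ncard
    rw [h1, h2]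
  have hlow : ∀ y : L, (lowerLabels y).ncard ≤ (coreLabels y).ncard := fun y =>
    Set.ncard_le_ncard (lowerLabels_subset_coreLabels y)
  have heq := (Finset.sum_eq_sum_iff_of_le fun y _ =>
    (hlow y).trans (ncard_coreLabels_le hU f y)).1 hsum x (Finset.mem_univ x)
  exact (Set.eq_of_subset_of_ncard_le (lowerLabels_subset_coreLabels x)
    ((ncard_coreLabels_le hU f x).trans heq.ge)).ge

end FacePoset

theorem theorem1p1 {L : Type*} [Lattice L] [BoundedOrder L] [Finite L]
    (hL : IsCongruenceUniform L) :
    (IsDistributiveLattice L ↔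
      Nonempty (CoreLabelOrder L ≃o {F : Set L // F ∈ canonicalJoinComplex L})) ∧
    (IsDistributiveLattice L ↔
      Set.range (fun x : L => coreLabels x) = {X : Set L | ∃ x : L, IsCanonicalJoinRep X x}) := by
  have hU := hL.uniqueLabels
  refine ⟨⟨fun hD => ⟨⟨equivFaces (L := L) hU, fun {x y} => ?_⟩⟩, fun ⟨f⟩ => ?_⟩,
    fun hD => ?_, fun h => ?_⟩
  · have hsub : ∀ x y : L, lowerLabels x ⊆ lowerLabels y ↔ coreLabels x ⊆ coreLabels y :=
      fun x y => by simp only [coreLabels_eq_lowerLabels_of_distributive hD]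
    exact hsub x y
  · exact hL.isDistributiveLattice (coreLabels_subset_of_orderIso hU f)
  · ext X
    simp only [Set.mem_range, Set.mem_ofPred_eq, coreLabels_eq_lowerLabels_of_distributive hD]
    refine exists_congr fun x => ⟨?_, (isCanonicalJoinRep_lowerLabels hU x).unique⟩
    rintro rfl
    exact isCanonicalJoinRep_lowerLabels hU x
  · refine hL.isDistributiveLattice fun x => ?_
    obtain ⟨y, hy⟩ := h.subset (Set.mem_range_self x)
    obtain rfl : x = y := (isLUB_coreLabels x).unique hy.1
    exact (hy.unique (isCanonicalJoinRep_lowerLabels hU x)).le
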